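/- A $k$-graph ($k\ge 0$) is a countable category $C$ with a functor $d\colon C\to\mathbb N^k$ such that whenever $d(a)=m+n$ there are unique arrows $a_1,a_2$ with $a=a_1a_2$, $d(a_1)=m$, $d(a_2)=n$. Identities are identified with objects; the product $ab$ is defined when the domain of $a$ equals the codomain of $b$; for a set $X$ of arrows, $XC=\{xs : x\in X,\ s\in C\}$ is the right ideal generated by $X$. Call $C$ *finitely aligned* if each $aC\cap bC$ is of the form $XC$ with $X$ finite (possibly empty); *row finite* if for each identity $e$ and each $m\in\mathbb N^k$ there are only finitely many arrows of degree $m$ with codomain $e$; and say that it has *no sources* if for each such $e$ and $m$ there is at least one. Arrows $a,b$ are *dependent* if $aC\cap bC\neq\varnothing$. $C$ is *aperiodic* if for all arrows $a\ne b$ with the same domain there is an arrow $u$ such that $au$ and $bu$ are defined and not dependent. $C$ is *cofinal* if for all identities $e,f$ there is a finite subset $X\subseteq fC$ such that each element of $fC$ is dependent on an element of $X$ and, for each $x\in X$, there is an arrow from the domain of $x$ to $e$. For $C$ finitely aligned with finitely many identities, let $\mathsf R(C)$ be the inverse monoid, under composition of partial maps, of all bijections $\theta\colon A\to B$ between finitely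 generated right ideals of $C$ with $\theta(as)=\theta(a)s$ whenever $a\in A$ and $as$ is defined. Its zero is the empty map. In any inverse monoid with zero, $a\le b$ means $a=ba^{-1}a$; $a$ and $b$ are *compatible* if $a^{-1}b$ and $ab^{-1}$ are idempotents; $s\equiv t$ means that each non-zero $x\le s$ has a non-zero lower bound in common with $t$, and each non-zero $y\le t$ has one in common with $s$. This $\equiv$ is a congruence, and $\mathsf B(C)=\mathsf R(C)/{\equiv}$. A *Boolean inverse monoid* is an inverse monoid with zero in which compatible pairs have joins, multiplication distributes over these joins, and the idempotents form a Boolean algebra under $\le$. It is *fundamental* if every element that commutes with all idempotents is itself an idempotent; *$0$-simplifying* if $\{0\}$ and the whole monoid are its only (non-empty) semigroup ideals closed under joins of compatible pairs; and *simple* if it is both fundamental and $0$-simplifying. **Theorem.** Let $C$ be a finitely aligned, row finite $k$-graph with finitely many identities and no sources. Then $\mathsf B(C)$ is a Boolean inverse monoid, and the following are equivalent: (1) $C$ is aperiodic and cofinal; (2) the Boolean inverse monoid $\mathsf B(C)$ is simple. -/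

import Mathlib

open CategoryTheory

universe u v

/-! ### Inverse monoids with zero -/

/-- An inverse monoid with zero: each element `a` has a unique inverse `a⁻¹` satisfying
`a a⁻¹ a = a` and `a⁻¹ a a⁻¹ = a⁻¹`. -/
class InverseMonoidWithZero (S : Type*) extends MonoidWithZero S, Inv S where
  mul_inv_mul_self : ∀ a : S, a * a⁻¹ * a = a
  inv_mul_mul_inv : ∀ a : S, a⁻¹ * a * a⁻¹ = a⁻¹
  eq_inv_of_mul : ∀ a b : S, a * b * a = a → b * a * b = b → b = a⁻¹

namespace InverseMonoidWithZero

section Basic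

variable {S : Type*} [InverseMonoidWithZero S]

theorem inv_inv_eq (a : S) : a⁻¹⁻¹ = a :=
  (eq_inv_of_mul a⁻¹ a (inv_mul_mul_inv a) (mul_inv_mul_self a)).symm

theorem inv_eq_of_idem {e : S} (he : e * e = e) : e⁻¹ = e :=
  (eq_inv_of_mul e e (by rw [he, he]) (by rw [he, he])).symm

theorem idem_inv_mul (a : S) : a⁻¹ * a * (a⁻¹ * a) = a⁻¹ * a := by
  rw [← mul_assoc, inv_mul_mul_inv]

theorem idem_mul_inv (a : S) : a * a⁻¹ * (a * a⁻¹) = a * a⁻¹ := by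
  rw [← mul_assoc, mul_inv_mul_self]

theorem idem_mul {e f : S} (he : e * e = e) (hf : f * f = f) : e * f * (e * f) = e * f := by
  have h1 := mul_inv_mul_self (e * f)
  have h2 := inv_mul_mul_inv (e * f)
  set x := (e * f)⁻¹ with hx
  have hfxe : f * x * e = x := by
    apply eq_inv_of_mul
    · calc e * f * (f * x * e) * (e * f) = e * (f * f) * x * (e * e) * f := by
            simp only [mul_assoc]
        _ = e * f * x * (e * f) := by rw [he, hf]; simp only [mul_assoc]
        _ = e * f := h1
    · calc f * x * e * (e * f) * (f * x * e) = f * (x * ((e * e) * (f * f)) * x) * e := by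
            simp only [mul_assoc]
        _ = f * x * e := by rw [he, hf, h2]
  have hxx : x * x = x := by
    calc x * x = f * x * e * (f * x * e) := by rw [hfxe]
      _ = f * (x * (e * f) * x) * e := by simp only [mul_assoc]
      _ = x := by rw [h2, hfxe]
  have : x = e * f := by
    rw [← inv_inv_eq (e * f), ← hx, inv_eq_of_idem hxx]
  rw [← this, hxx]

theorem idem_comm {e f : S} (he : e * e = e) (hf : f * f = f) : e * f = f * e := by
  have h1 := idem_mul he hf
  have h2 := idem_mul hf he
  have : f * e = (e * f)⁻¹ := by
    apply eq_inv_of_mul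
    · calc e * f * (f * e) * (e * f) = e * (f * f) * (e * e) * f := by simp only [mul_assoc]
        _ = e * f * (e * f) := by rw [he, hf]; simp only [mul_assoc]
        _ = e * f := h1
    · calc f * e * (e * f) * (f * e) = f * (e * e) * (f * f) * e := by simp only [mul_assoc]
        _ = f * e * (f * e) := by rw [he, hf]; simp only [mul_assoc]
        _ = f * e := h2
  rw [this, inv_eq_of_idem h1]

theorem mul_inv_rev_eq (a b : S) : (a * b)⁻¹ = b⁻¹ * a⁻¹ := by
  have hc := idem_comm (idem_mul_inv b) (idem_inv_mul a)
  symm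
  apply eq_inv_of_mul
  · calc a * b * (b⁻¹ * a⁻¹) * (a * b) = a * ((b * b⁻¹) * (a⁻¹ * a)) * b := by
          simp only [mul_assoc]
      _ = (a * a⁻¹ * a) * (b * b⁻¹ * b) := by rw [hc]; simp only [mul_assoc]
      _ = a * b := by rw [mul_inv_mul_self, mul_inv_mul_self]
  · calc b⁻¹ * a⁻¹ * (a * b) * (b⁻¹ * a⁻¹) = b⁻¹ * ((a⁻¹ * a) * (b * b⁻¹)) * a⁻¹ := by
          simp only [mul_assoc]
      _ = (b⁻¹ * b * b⁻¹) * (a⁻¹ * a * a⁻¹) := by rw [← hc]; simp only [mul_assoc]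
      _ = b⁻¹ * a⁻¹ := by rw [inv_mul_mul_inv, inv_mul_mul_inv]

theorem idem_conj {e : S} (b : S) (he : e * e = e) :
    (b⁻¹ * e * b) * (b⁻¹ * e * b) = b⁻¹ * e * b := by
  have hc := idem_comm (idem_mul_inv b) he
  calc (b⁻¹ * e * b) * (b⁻¹ * e * b) = b⁻¹ * e * ((b * b⁻¹) * e) * b := by simp only [mul_assoc]
    _ = b⁻¹ * (e * e) * (b * b⁻¹ * b) := by rw [hc]; simp only [mul_assoc]
    _ = b⁻¹ * e * b := by rw [he, mul_inv_mul_self]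

theorem idem_mul_eq {e : S} (b : S) (he : e * e = e) : e * b = b * (b⁻¹ * e * b) := by
  have hc := idem_comm (idem_mul_inv b) he
  calc e * b = e * (b * b⁻¹ * b) := by rw [mul_inv_mul_self]
    _ = e * (b * b⁻¹) * b := by simp only [mul_assoc]
    _ = b * (b⁻¹ * e * b) := by rw [← hc]; simp only [mul_assoc]

theorem mul_idem_eq {e : S} (b : S) (he : e * e = e) : b * e = (b * e * b⁻¹) * b := by
  have hc := idem_comm (idem_inv_mul b) he
  calc b * e = b * b⁻¹ * b * e := by rw [mul_inv_mul_self]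
    _ = b * ((b⁻¹ * b) * e) := by simp only [mul_assoc]
    _ = (b * e * b⁻¹) * b := by rw [hc]; simp only [mul_assoc]

theorem eq_mul_inv_mul_iff {a b : S} :
    a = b * a⁻¹ * a ↔ ∃ e : S, e * e = e ∧ a = b * e := by
  constructor
  · intro h
    exact ⟨a⁻¹ * a, idem_inv_mul a, by rw [← mul_assoc]; exact h⟩
  · rintro ⟨e, he, rfl⟩
    have hc := idem_comm (idem_inv_mul b) he
    rw [mul_inv_rev_eq, inv_eq_of_idem he]
    symm
    calc b * (e * b⁻¹) * (b * e) = b * (e * (b⁻¹ * b)) * e := by simp only [mul_assoc]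
      _ = (b * b⁻¹ * b) * (e * e) := by rw [← hc]; simp only [mul_assoc]
      _ = b * e := by rw [he, mul_inv_mul_self]

/-- The natural partial order: `a ≤ b` if and only if `a = b a⁻¹ a`. -/
instance naturalOrder : PartialOrder S where
  le a b := a = b * a⁻¹ * a
  le_refl a := (mul_inv_mul_self a).symm
  le_trans a b c hab hbc := by
    obtain ⟨e, he, h1⟩ := eq_mul_inv_mul_iff.1 hab
    obtain ⟨f, hf, h2⟩ := eq_mul_inv_mul_iff.1 hbc
    exact eq_mul_inv_mul_iff.2 ⟨f * e, idem_mul hf he, by rw [h1, h2, mul_assoc]⟩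
  le_antisymm a b hab hba := by
    obtain ⟨e, he, h1⟩ := eq_mul_inv_mul_iff.1 hab
    obtain ⟨f, hf, h2⟩ := eq_mul_inv_mul_iff.1 hba
    have h3 : a * e = a := by rw [h1, mul_assoc, he]
    calc a = a * f * e := by rw [← h2, ← h1]
      _ = a * e * f := by rw [mul_assoc, idem_comm hf he, mul_assoc]
      _ = b := by rw [h3, ← h2]

theorem le_def {a b : S} : a ≤ b ↔ a = b * a⁻¹ * a := Iff.rfl

theorem le_iff_mul_idem {a b : S} : a ≤ b ↔ ∃ e : S, e * e = e ∧ a = b * e :=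
  eq_mul_inv_mul_iff

theorem le_iff_idem_mul {a b : S} : a ≤ b ↔ ∃ e : S, e * e = e ∧ a = e * b := by
  rw [le_iff_mul_idem]
  constructor
  · rintro ⟨e, he, rfl⟩
    refine ⟨b * e * b⁻¹, ?_, mul_idem_eq b he⟩
    have := idem_conj b⁻¹ he
    rwa [inv_inv_eq] at this
  · rintro ⟨e, he, rfl⟩
    exact ⟨b⁻¹ * e * b, idem_conj b he, idem_mul_eq b he⟩

theorem le_mul_left {a b : S} (c : S) (h : a ≤ b) : c * a ≤ c * b := by
  obtain ⟨e, he, rfl⟩ := le_iff_mul_idem.1 h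
  exact le_iff_mul_idem.2 ⟨e, he, (mul_assoc _ _ _).symm⟩

theorem le_mul_right {a b : S} (c : S) (h : a ≤ b) : a * c ≤ b * c := by
  obtain ⟨e, he, rfl⟩ := le_iff_idem_mul.1 h
  exact le_iff_idem_mul.2 ⟨e, he, mul_assoc _ _ _⟩

theorem inv_le {a b : S} (h : a ≤ b) : a⁻¹ ≤ b⁻¹ := by
  obtain ⟨e, he, rfl⟩ := le_iff_mul_idem.1 h
  exact le_iff_idem_mul.2 ⟨e, he, by rw [mul_inv_rev_eq, inv_eq_of_idem he]⟩

theorem inv_ne_zero_of_ne {a : S} (h : a ≠ 0) : a⁻¹ ≠ 0 := fun h0 => h <| by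
  rw [← mul_inv_mul_self a, h0, mul_zero, zero_mul]

theorem idem_mul_le {e : S} (b : S) (he : e * e = e) : e * b ≤ b :=
  le_iff_idem_mul.2 ⟨e, he, rfl⟩

theorem mul_idem_le {e : S} (b : S) (he : e * e = e) : b * e ≤ b :=
  le_iff_mul_idem.2 ⟨e, he, rfl⟩

theorem mul_inv_mul_of_le_mul {u s x : S} (h : x ≤ u * s) : u * u⁻¹ * x = x := by
  obtain ⟨e, -, rfl⟩ := le_iff_mul_idem.1 h
  calc u * u⁻¹ * (u * s * e) = (u * u⁻¹ * u) * s * e := by simp only [mul_assoc]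
    _ = u * s * e := by rw [mul_inv_mul_self]

theorem mul_inv_mul_of_le_mul' {u s x : S} (h : x ≤ s * u) : x * u⁻¹ * u = x := by
  obtain ⟨e, -, rfl⟩ := le_iff_idem_mul.1 h
  calc e * (s * u) * u⁻¹ * u = e * s * (u * u⁻¹ * u) := by simp only [mul_assoc]
    _ = e * (s * u) := by rw [mul_inv_mul_self, mul_assoc]

end Basic

section Lenz

variable {S : Type*} [InverseMonoidWithZero S]

/-- Half of the Lenz relation: each non-zero element below `s` has a non-zero lower bound
in common with `t`. -/
def LenzLE (s t : S) : Prop :=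
  ∀ x : S, x ≠ 0 → x ≤ s → ∃ z : S, z ≠ 0 ∧ z ≤ x ∧ z ≤ t

theorem LenzLE.trans {a b c : S} (h : LenzLE a b) (h' : LenzLE b c) : LenzLE a c := by
  intro x hx hxa
  obtain ⟨z, hz, hzx, hzb⟩ := h x hx hxa
  obtain ⟨w, hw, hwz, hwc⟩ := h' z hz hzb
  exact ⟨w, hw, hwz.trans hzx, hwc⟩

theorem LenzLE.mul_left {s t : S} (u : S) (h : LenzLE s t) : LenzLE (u * s) (u * t) := by
  intro x hx hxs
  have hux := mul_inv_mul_of_le_mul hxs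
  have hy : u⁻¹ * x ≠ 0 := fun h0 => hx (by rw [← hux, mul_assoc, h0, mul_zero])
  have hys : u⁻¹ * x ≤ s := by
    refine (le_mul_left u⁻¹ hxs).trans ?_
    rw [← mul_assoc]
    exact idem_mul_le s (idem_inv_mul u)
  obtain ⟨z, hz, hzy, hzt⟩ := h _ hy hys
  refine ⟨u * z, fun h0 => hz ?_, ?_, le_mul_left u hzt⟩
  · have := mul_inv_mul_of_le_mul hzy
    rw [inv_inv_eq] at this
    rw [← this, mul_assoc, h0, mul_zero]
  · have := le_mul_left u hzy
    rwa [← mul_assoc, hux] at this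

theorem LenzLE.inv {s t : S} (h : LenzLE s t) : LenzLE s⁻¹ t⁻¹ := by
  intro x hx hxs
  obtain ⟨z, hz, hzx, hzt⟩ := h x⁻¹ (inv_ne_zero_of_ne hx) (by simpa [inv_inv_eq] using inv_le hxs)
  exact ⟨z⁻¹, inv_ne_zero_of_ne hz, by simpa [inv_inv_eq] using inv_le hzx, inv_le hzt⟩

theorem LenzLE.mul_right {s t : S} (u : S) (h : LenzLE s t) : LenzLE (s * u) (t * u) := by
  have := (h.inv.mul_left u⁻¹).inv
  simpa [mul_inv_rev_eq, inv_inv_eq] using this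

variable (S) in
/-- The Lenz congruence `≡`: `s ≡ t` if and only if for each `0 < x ≤ s` there is a non-zero
element below both `x` and `t`, and for each `0 < y ≤ t` there is a non-zero element below
both `y` and `s`. -/
def lenzCon : Con S where
  r s t := LenzLE s t ∧ LenzLE t s
  iseqv :=
    { refl := fun _ => ⟨fun x hx h => ⟨x, hx, le_rfl, h⟩, fun x hx h => ⟨x, hx, le_rfl, h⟩⟩
      symm := fun h => ⟨h.2, h.1⟩
      trans := fun h h' => ⟨h.1.trans h'.1, h'.2.trans h.2⟩ }
  mul' := fun h h' =>
    ⟨(h.1.mul_right _).trans (h'.1.mul_left _), (h'.2.mul_left _).trans (h.2.mul_right _)⟩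

variable (S) in
/-- The quotient `S/≡` of `S` by its Lenz congruence. -/
def LenzQuotient : Type _ := (lenzCon S).Quotient

/-- The class `[s]` of `s` in `S/≡`. -/
def lenzMk (s : S) : LenzQuotient S := (s : (lenzCon S).Quotient)

theorem lenzMk_eq_iff {s t : S} : lenzMk s = lenzMk t ↔ LenzLE s t ∧ LenzLE t s :=
  (lenzCon S).eq

theorem lenzMk_surjective : Function.Surjective (lenzMk : S → LenzQuotient S) :=
  Quotient.mk''_surjective

instance : Monoid (LenzQuotient S) := inferInstanceAs (Monoid (lenzCon S).Quotient)

instance : Zero (LenzQuotient S) := ⟨lenzMk 0⟩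

instance : Inv (LenzQuotient S) :=
  ⟨Quotient.map' (fun s : S => s⁻¹) fun _ _ h => ⟨h.1.inv, h.2.inv⟩⟩

theorem lenzMk_mul (s t : S) : lenzMk (s * t) = lenzMk s * lenzMk t := rfl
theorem lenzMk_one : lenzMk (1 : S) = 1 := rfl
theorem lenzMk_zero : lenzMk (0 : S) = 0 := rfl
theorem lenzMk_inv (s : S) : lenzMk s⁻¹ = (lenzMk s)⁻¹ := rfl

theorem exists_idem_lenzMk {p : LenzQuotient S} (hp : p * p = p) :
    ∃ e : S, e * e = e ∧ lenzMk e = p := by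
  obtain ⟨a, rfl⟩ := lenzMk_surjective p
  refine ⟨a * (a * a)⁻¹ * a, ?_, ?_⟩
  · calc a * (a * a)⁻¹ * a * (a * (a * a)⁻¹ * a)
        = a * ((a * a)⁻¹ * (a * a) * (a * a)⁻¹) * a := by simp only [mul_assoc]
      _ = _ := by rw [inv_mul_mul_inv]
  · have h := congrArg lenzMk (mul_inv_mul_self (a * a))
    simp only [lenzMk_mul, hp] at h
    simpa only [lenzMk_mul] using h

instance : InverseMonoidWithZero (LenzQuotient S) where
  zero_mul p := by
    obtain ⟨a, rfl⟩ := lenzMk_surjective p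
    rw [← lenzMk_zero, ← lenzMk_mul, zero_mul]
  mul_zero p := by
    obtain ⟨a, rfl⟩ := lenzMk_surjective p
    rw [← lenzMk_zero, ← lenzMk_mul, mul_zero]
  mul_inv_mul_self p := by
    obtain ⟨a, rfl⟩ := lenzMk_surjective p
    rw [← lenzMk_inv, ← lenzMk_mul, ← lenzMk_mul, mul_inv_mul_self]
  inv_mul_mul_inv p := by
    obtain ⟨a, rfl⟩ := lenzMk_surjective p
    rw [← lenzMk_inv, ← lenzMk_mul, ← lenzMk_mul, inv_mul_mul_inv]
  eq_inv_of_mul p q h1 h2 := by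
    have h3 : p * p⁻¹ * p = p := by
      obtain ⟨a, rfl⟩ := lenzMk_surjective p
      rw [← lenzMk_inv, ← lenzMk_mul, ← lenzMk_mul, mul_inv_mul_self]
    have h4 : p⁻¹ * p * p⁻¹ = p⁻¹ := by
      obtain ⟨a, rfl⟩ := lenzMk_surjective p
      rw [← lenzMk_inv, ← lenzMk_mul, ← lenzMk_mul, inv_mul_mul_inv]
    have comm : ∀ x y : LenzQuotient S, x * x = x → y * y = y → x * y = y * x := by
      intro x y hx hy
      obtain ⟨e, he, rfl⟩ := exists_idem_lenzMk hx
      obtain ⟨f, hf, rfl⟩ := exists_idem_lenzMk hy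
      rw [← lenzMk_mul, ← lenzMk_mul, idem_comm he hf]
    set r := p⁻¹
    have c1 : (q * p) * (r * p) = (r * p) * (q * p) :=
      comm _ _ (by rw [← mul_assoc, h2]) (by rw [← mul_assoc, h4])
    have c2 : (p * q) * (p * r) = (p * r) * (p * q) :=
      comm _ _ (by rw [← mul_assoc, h1]) (by rw [← mul_assoc, h3])
    calc q = q * (p * r * p) * q := by rw [h3, h2]
      _ = (q * p) * (r * p) * q := by simp only [mul_assoc]
      _ = r * (p * q * p) * q := by rw [c1]; simp only [mul_assoc]
      _ = r * p * q := by rw [h1]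
      _ = r * p * r * (p * q) := by rw [h4, mul_assoc]
      _ = r * ((p * r) * (p * q)) := by simp only [mul_assoc]
      _ = r * (p * q * p) * r := by rw [← c2]; simp only [mul_assoc]
      _ = r := by rw [h1, h4]

end Lenz

section Properties

variable (S : Type*) [InverseMonoidWithZero S]

variable {S} in
/-- `a` and `b` are compatible if `a⁻¹ b` and `a b⁻¹` are both idempotents. -/
def Compatible (a b : S) : Prop :=
  IsIdempotentElem (a⁻¹ * b) ∧ IsIdempotentElem (a * b⁻¹)

/-- Compatible pairs have joins in the natural partial order, and multiplication distributes
over such joins. -/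
structure IsDistributive : Prop where
  exists_join : ∀ a b : S, Compatible a b → ∃ c : S, IsLUB {a, b} c
  mul_join : ∀ s a b c : S, Compatible a b → IsLUB {a, b} c → IsLUB {s * a, s * b} (s * c)
  join_mul : ∀ s a b c : S, Compatible a b → IsLUB {a, b} c → IsLUB {a * s, b * s} (c * s)

/-- A Boolean inverse monoid is a distributive inverse monoid in which the poset of idempotents,
with the natural partial order, is a Boolean algebra. -/
def IsBooleanInverseMonoid : Prop :=
  IsDistributive S ∧
    ∃ B : BooleanAlgebra {e : S // IsIdempotentElem e},
      ∀ e f : {e : S // IsIdempotentElem e}, B.le e f ↔ (e : S) ≤ (f : S)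

/-- The only elements that commute with all the idempotents are themselves idempotents. -/
def IsFundamental : Prop :=
  ∀ a : S, (∀ e : S, IsIdempotentElem e → a * e = e * a) → IsIdempotentElem a

variable {S} in
/-- An additive ideal: a (non-empty) semigroup ideal closed under joins of compatible pairs. -/
structure IsAdditiveIdeal (I : Set S) : Prop where
  nonempty : I.Nonempty
  mul_left_mem : ∀ s a : S, a ∈ I → s * a ∈ I
  mul_right_mem : ∀ s a : S, a ∈ I → a * s ∈ I
  join_mem : ∀ a b c : S, a ∈ I → b ∈ I → Compatible a b → IsLUB {a, b} c → c ∈ I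

/-- The only additive ideals are the trivial ones, `{0}` and the whole monoid. -/
def IsZeroSimplifying : Prop :=
  ∀ I : Set S, IsAdditiveIdeal I → I = {0} ∨ I = Set.univ

/-- Simplicity (for a Boolean inverse monoid): fundamental and `0`-simplifying. -/
def IsSimple : Prop :=
  IsFundamental S ∧ IsZeroSimplifying S

end Properties

end InverseMonoidWithZero

/-! ### Categories as sets of arrows -/

/-- The arrows of a category `C`. The objects of `C` play the role of the identities. -/
@[ext]
structure Arr (C : Type u) [Category.{v} C] where
  dom : C
  cod : C
  hom : dom ⟶ cod

namespace Arr

variable {C : Type u} [Category.{v} C]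

/-- The identity arrow at an object. -/
def one (x : C) : Arr C := ⟨x, x, 𝟙 x⟩

/-- The product `ab` (first `b`, then `a`), defined when the domain of `a` is the codomain
of `b`. -/
def comp (a b : Arr C) (h : a.dom = b.cod) : Arr C :=
  ⟨b.dom, a.cod, b.hom ≫ eqToHom h.symm ≫ a.hom⟩

theorem comp_one (a : Arr C) : a.comp (one a.dom) rfl = a := by
  simp [comp, one]

theorem comp_assoc (a b c : Arr C) (h : a.dom = b.cod) (h' : b.dom = c.cod) :
    (a.comp b h).comp c h' = a.comp (b.comp c h') h := by
  simp [comp]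

/-- The right ideal `XC = {xs : x ∈ X, s ∈ C}` generated by a set `X` of arrows. -/
def rightIdeal (X : Set (Arr C)) : Set (Arr C) :=
  {c | ∃ x ∈ X, ∃ (s : Arr C) (h : x.dom = s.cod), c = x.comp s h}

/-- `A = XC` for some finite set `X`. -/
def IsFGRightIdeal (A : Set (Arr C)) : Prop :=
  ∃ X : Set (Arr C), X.Finite ∧ A = rightIdeal X

/-- `a` and `b` are dependent (comparable) if `aC ∩ bC` is non-empty. -/
def Dependent (a b : Arr C) : Prop :=
  (rightIdeal {a} ∩ rightIdeal {b}).Nonempty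

end Arr

section OfArrows

open Arr

/-- `C` is finitely aligned if `aC ∩ bC` is finitely generated (possibly empty) for all
arrows `a` and `b`. -/
class FinitelyAligned (C : Type u) [Category.{v} C] : Prop where
  inter_fg : ∀ a b : Arr C, IsFGRightIdeal (rightIdeal {a} ∩ rightIdeal {b})

section Morphisms

variable {C : Type u} [Category.{v} C]

theorem Arr.rightIdeal_eq_biUnion (X : Set (Arr C)) :
    rightIdeal X = ⋃ x ∈ X, rightIdeal {x} := by
  ext c
  simp [rightIdeal]

theorem Arr.IsFGRightIdeal.biUnion {ι : Type*} {T : Set ι} (hT : T.Finite)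
    {A : ι → Set (Arr C)} (h : ∀ i ∈ T, IsFGRightIdeal (A i)) :
    IsFGRightIdeal (⋃ i ∈ T, A i) := by
  classical
  choose! X hX hA using h
  refine ⟨⋃ i ∈ T, X i, hT.biUnion hX, ?_⟩
  ext c
  simp only [Set.mem_iUnion, rightIdeal, Set.mem_ofPred_eq]
  constructor
  · rintro ⟨i, hi, hc⟩
    rw [hA i hi] at hc
    obtain ⟨x, hx, s, hs, rfl⟩ := hc
    exact ⟨x, ⟨i, hi, hx⟩, s, hs, rfl⟩
  · rintro ⟨x, ⟨i, hi, hx⟩, s, hs, rfl⟩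
    refine ⟨i, hi, ?_⟩
    rw [hA i hi]
    exact ⟨x, hx, s, hs, rfl⟩

theorem Arr.IsFGRightIdeal.inter [FinitelyAligned C] {A B : Set (Arr C)}
    (hA : IsFGRightIdeal A) (hB : IsFGRightIdeal B) : IsFGRightIdeal (A ∩ B) := by
  obtain ⟨X, hX, rfl⟩ := hA
  obtain ⟨Y, hY, rfl⟩ := hB
  have : rightIdeal X ∩ rightIdeal Y =
      ⋃ p ∈ X ×ˢ Y, rightIdeal {p.1} ∩ rightIdeal {p.2} := by
    ext c
    rw [rightIdeal_eq_biUnion X, rightIdeal_eq_biUnion Y]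
    simp only [Set.mem_inter_iff, Set.mem_iUnion, Set.mem_prod, Prod.exists, exists_prop]
    constructor
    · rintro ⟨⟨x, hx, h1⟩, y, hy, h2⟩
      exact ⟨x, y, ⟨hx, hy⟩, h1, h2⟩
    · rintro ⟨x, y, ⟨hx, hy⟩, h1, h2⟩
      exact ⟨⟨x, hx, h1⟩, y, hy, h2⟩
  rw [this]
  exact IsFGRightIdeal.biUnion (hX.prod hY) fun p _ => FinitelyAligned.inter_fg p.1 p.2

theorem Arr.isFGRightIdeal_univ [Finite C] : IsFGRightIdeal (Set.univ : Set (Arr C)) := by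
  refine ⟨Set.range one, Set.finite_range _, ?_⟩
  symm
  rw [Set.eq_univ_iff_forall]
  intro a
  refine ⟨one a.cod, ⟨a.cod, rfl⟩, a, rfl, ?_⟩
  simp [comp, one]

/-- A partial bijection `θ` on the set of arrows of `C` is a bijective morphism between finitely
generated right ideals if its domain of definition and its image are finitely generated right
ideals and, whenever `θ(a)` and `as` are defined, `θ(as) = θ(a)s` (both sides being defined). -/
structure IsBijectiveMorphism (θ : Arr C ≃. Arr C) : Prop where
  fg_dom : IsFGRightIdeal {a | ∃ b, b ∈ θ a}
  fg_im : IsFGRightIdeal {b | ∃ a, b ∈ θ a}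
  map_comp : ∀ a b : Arr C, b ∈ θ a → ∀ (s : Arr C) (h : a.dom = s.cod),
    ∃ h' : b.dom = s.cod, b.comp s h' ∈ θ (a.comp s h)

theorem IsBijectiveMorphism.symm {θ : Arr C ≃. Arr C} (h : IsBijectiveMorphism θ) :
    IsBijectiveMorphism θ.symm where
  fg_dom := by simpa only [PEquiv.mem_iff_mem] using h.fg_im
  fg_im := by simpa only [PEquiv.mem_iff_mem] using h.fg_dom
  map_comp a b hb s hs := by
    rw [PEquiv.mem_iff_mem] at hb
    obtain ⟨h1, -⟩ := h.map_comp b a hb (one b.dom) rfl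
    have h2 : b.dom = s.cod := h1.symm.trans hs
    obtain ⟨_, h3⟩ := h.map_comp b a hb s h2
    exact ⟨h2, by rw [PEquiv.mem_iff_mem]; exact h3⟩

/-- The image of a finitely generated right ideal is finitely generated. -/
theorem IsBijectiveMorphism.image_fg {θ : Arr C ≃. Arr C} (h : IsBijectiveMorphism θ)
    {A : Set (Arr C)} (hA : IsFGRightIdeal A) (hdom : ∀ a ∈ A, ∃ b, b ∈ θ a) :
    IsFGRightIdeal {b | ∃ a ∈ A, b ∈ θ a} := by
  obtain ⟨X, hX, rfl⟩ := hA
  have hsub : ∀ x ∈ X, x ∈ rightIdeal X := fun x hx => ⟨x, hx, one x.dom, rfl, (comp_one x).symm⟩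
  choose! f hf using hdom
  refine ⟨f '' X, hX.image f, ?_⟩
  ext b
  constructor
  · rintro ⟨a, ⟨x, hx, s, hs, rfl⟩, hb⟩
    obtain ⟨h', h2⟩ := h.map_comp x (f x) (hf x (hsub x hx)) s hs
    exact ⟨f x, ⟨x, hx, rfl⟩, s, h', Option.mem_unique hb h2⟩
  · rintro ⟨_, ⟨x, hx, rfl⟩, s, hs, rfl⟩
    obtain ⟨h1, -⟩ := h.map_comp x (f x) (hf x (hsub x hx)) (one x.dom) rfl
    obtain ⟨h', h2⟩ := h.map_comp x (f x) (hf x (hsub x hx)) s (h1.symm.trans hs)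
    exact ⟨_, ⟨x, hx, s, h1.symm.trans hs, rfl⟩, h2⟩

theorem IsBijectiveMorphism.trans [FinitelyAligned C] {φ θ : Arr C ≃. Arr C}
    (hφ : IsBijectiveMorphism φ) (hθ : IsBijectiveMorphism θ) :
    IsBijectiveMorphism (φ.trans θ) where
  fg_dom := by
    have := hφ.symm.image_fg (hφ.fg_im.inter hθ.fg_dom)
      (by rintro b ⟨⟨a, ha⟩, -⟩; exact ⟨a, by rwa [PEquiv.mem_iff_mem]⟩)
    convert this using 1
    ext a
    simp only [PEquiv.mem_trans, PEquiv.mem_iff_mem, Set.mem_ofPred_eq, Set.mem_inter_iff]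
    constructor
    · rintro ⟨c, b, hb, hc⟩
      exact ⟨b, ⟨⟨a, hb⟩, c, hc⟩, hb⟩
    · rintro ⟨b, ⟨-, c, hc⟩, hb⟩
      exact ⟨c, b, hb, hc⟩
  fg_im := by
    have := hθ.image_fg (hφ.fg_im.inter hθ.fg_dom) (fun _ hb => hb.2)
    convert this using 1
    ext c
    simp only [PEquiv.mem_trans, Set.mem_ofPred_eq, Set.mem_inter_iff]
    constructor
    · rintro ⟨a, b, hb, hc⟩
      exact ⟨b, ⟨⟨a, hb⟩, c, hc⟩, hc⟩
    · rintro ⟨b, ⟨⟨a, hb⟩, -⟩, hc⟩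
      exact ⟨a, b, hb, hc⟩
  map_comp a c hac s hs := by
    obtain ⟨b, hb, hc⟩ := (PEquiv.mem_trans _ _ _ _).1 hac
    obtain ⟨h1, h2⟩ := hφ.map_comp a b hb s hs
    obtain ⟨h3, h4⟩ := hθ.map_comp b c hc s h1
    exact ⟨h3, (PEquiv.mem_trans _ _ _ _).2 ⟨_, h2, h4⟩⟩

theorem IsBijectiveMorphism.refl [Finite C] :
    IsBijectiveMorphism (PEquiv.refl (Arr C)) where
  fg_dom := by simpa using isFGRightIdeal_univ
  fg_im := by simpa using isFGRightIdeal_univ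
  map_comp a b hb s hs := by
    simp only [PEquiv.refl_apply, Option.mem_some_iff] at hb
    subst hb
    exact ⟨hs, rfl⟩

theorem IsBijectiveMorphism.bot : IsBijectiveMorphism (⊥ : Arr C ≃. Arr C) where
  fg_dom := ⟨∅, Set.finite_empty, by simp [rightIdeal]⟩
  fg_im := ⟨∅, Set.finite_empty, by simp [rightIdeal]⟩
  map_comp a b hb := by simp at hb

end Morphisms

/-- `R(C)`: the bijective morphisms between finitely generated right ideals of `C`. -/
def RMonoid (C : Type u) [Category.{v} C] : Type (max u v) :=
  {θ : Arr C ≃. Arr C // IsBijectiveMorphism θ}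

/-- `R(C)` is an inverse monoid with zero under composition of partial bijections (the product
`θφ` is `φ` followed by `θ`). Its zero is the empty map and its identity the identity of `C`. -/
instance (C : Type u) [Category.{v} C] [Finite C] [FinitelyAligned C] :
    InverseMonoidWithZero (RMonoid C) where
  mul θ φ := ⟨φ.1.trans θ.1, φ.2.trans θ.2⟩
  one := ⟨PEquiv.refl _, IsBijectiveMorphism.refl⟩
  zero := ⟨⊥, IsBijectiveMorphism.bot⟩
  inv θ := ⟨θ.1.symm, θ.2.symm⟩
  mul_assoc θ φ ψ := Subtype.ext (PEquiv.trans_assoc ψ.1 φ.1 θ.1).symm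
  one_mul θ := Subtype.ext (PEquiv.trans_refl θ.1)
  mul_one θ := Subtype.ext (PEquiv.refl_trans θ.1)
  zero_mul θ := Subtype.ext (PEquiv.trans_bot θ.1)
  mul_zero θ := Subtype.ext (PEquiv.bot_trans θ.1)
  mul_inv_mul_self θ := by
    refine Subtype.ext (PEquiv.ext fun a => Option.ext fun b => ?_)
    change b ∈ (θ.1.trans (θ.1.symm.trans θ.1)) a ↔ b ∈ θ.1 a
    simp only [PEquiv.mem_trans, PEquiv.mem_iff_mem]
    constructor
    · rintro ⟨c, hc, d, hd, hb⟩
      obtain rfl := θ.1.inj hd hc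
      exact hb
    · exact fun hb => ⟨b, hb, a, hb, hb⟩
  inv_mul_mul_inv θ := by
    refine Subtype.ext (PEquiv.ext fun a => Option.ext fun b => ?_)
    change b ∈ (θ.1.symm.trans (θ.1.trans θ.1.symm)) a ↔ b ∈ θ.1.symm a
    simp only [PEquiv.mem_trans, PEquiv.mem_iff_mem]
    constructor
    · rintro ⟨c, hc, d, hd, hb⟩
      obtain rfl := Option.mem_unique hc hd
      exact hb
    · exact fun hb => ⟨b, hb, a, hb, hb⟩
  eq_inv_of_mul θ φ h1 h2 := by
    have h1' : θ.1.trans (φ.1.trans θ.1) = θ.1 := congrArg Subtype.val h1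
    have h2' : φ.1.trans (θ.1.trans φ.1) = φ.1 := congrArg Subtype.val h2
    refine Subtype.ext (PEquiv.ext fun a => Option.ext fun b => ?_)
    change b ∈ φ.1 a ↔ b ∈ θ.1.symm a
    rw [PEquiv.mem_iff_mem]
    constructor
    · intro hb
      rw [← h2'] at hb
      simp only [PEquiv.mem_trans] at hb
      obtain ⟨c, hc, d, hd, hb⟩ := hb
      have hb' : b ∈ φ.1 a := by
        rw [← h2']; simp only [PEquiv.mem_trans]; exact ⟨c, hc, d, hd, hb⟩
      obtain rfl := Option.mem_unique hc hb'
      obtain rfl := φ.1.inj hb hc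
      exact hd
    · intro hb
      have hb' := hb
      rw [← h1'] at hb'
      simp only [PEquiv.mem_trans] at hb'
      obtain ⟨c, hc, d, hd, ha⟩ := hb'
      obtain rfl := Option.mem_unique hc hb
      obtain rfl := θ.1.inj ha hc
      exact hd

/-- `B(C) = R(C)/≡`. -/
abbrev BMonoid (C : Type u) [Category.{v} C] [Finite C] [FinitelyAligned C] : Type (max u v) :=
  InverseMonoidWithZero.LenzQuotient (RMonoid C)

/-! ### Higher rank graphs -/

/-- A `k`-graph: a countable category with a degree functor to `ℕᵏ` that has the unique
factorization property. -/
structure KGraph (k : ℕ) (C : Type u) [Category.{v} C] where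
  countable : Countable (Arr C)
  deg : Arr C → (Fin k → ℕ)
  deg_one : ∀ x : C, deg (one x) = 0
  deg_comp : ∀ (a b : Arr C) (h : a.dom = b.cod), deg (a.comp b h) = deg a + deg b
  factorization : ∀ (a : Arr C) (m n : Fin k → ℕ), deg a = m + n →
    ∃! p : Arr C × Arr C,
      deg p.1 = m ∧ deg p.2 = n ∧ ∃ h : p.1.dom = p.2.cod, a = p.1.comp p.2 h

namespace KGraph

variable {k : ℕ} {C : Type u} [Category.{v} C]

/-- For each identity `e` and each degree `m` there is an arrow of degree `m` with codomain
`e`. -/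
def NoSources (G : KGraph k C) : Prop :=
  ∀ (e : C) (m : Fin k → ℕ), ∃ x : Arr C, x.cod = e ∧ G.deg x = m

/-- For each identity `e` and each degree `m` there are finitely many arrows of degree `m` with
codomain `e`. -/
def RowFinite (G : KGraph k C) : Prop :=
  ∀ (e : C) (m : Fin k → ℕ), {x : Arr C | x.cod = e ∧ G.deg x = m}.Finite

end KGraph

section Conditions

variable (C : Type u) [Category.{v} C]

/-- For all `a ≠ b` with the same domain there is an arrow `u` such that `au` and `bu` (are
defined and) are not dependent. -/
def IsAperiodicCategory : Prop :=
  ∀ (a b : Arr C) (hab : a.dom = b.dom), a ≠ b →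
    ∃ (u : Arr C) (h : a.dom = u.cod), ¬ Dependent (a.comp u h) (b.comp u (hab.symm.trans h))

variable {C} in
/-- `X` is a large subset of `fC`: it is contained in `fC`, and each element of `fC` is dependent
on an element of `X`. -/
def IsLargeIn (X : Set (Arr C)) (f : C) : Prop :=
  (∀ x ∈ X, x.cod = f) ∧ ∀ b : Arr C, b.cod = f → ∃ x ∈ X, Dependent b x

/-- For all identities `e` and `f` there is a finite large subset `X` of `fC` such that for each
`x ∈ X` there is an arrow with codomain `e` whose domain is the domain of `x`. -/
def IsCofinalCategory : Prop :=
  ∀ e f : C, ∃ X : Set (Arr C), X.Finite ∧ IsLargeIn X f ∧ ∀ x ∈ X, Nonempty (x.dom ⟶ e)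

end Conditions

end OfArrows

/-!
The proof works with `R(C)` as a set of relations on arrows (`RMonoid.Rel`). By
`InverseMonoidWithZero.lenzMk_le_iff` the natural order of `S/≡` is the preorder `LenzLE` on `S`,
and `RMonoid.lenzLE_iff` describes it on `R(C)`: `[θ] ≤ [φ]` means that each `a ↦ b` in `θ` extends
to some `au ↦ bu` in `φ`.

The unique factorization property makes a `k`-graph cancellative. Right cancellation makes `≡`
idempotent pure (`RMonoid.idem_of_lenzMk_idem`): if `[θ]` is idempotent, so is `θ`. Hence
compatible elements of `B(C)` have representatives whose union is again in `R(C)`, and the class of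
this union is their join (`RMonoid.isLUB_lenzMk`); distributivity follows. Row finiteness and the
absence of sources give complements (`KGraph.exists_complement`): for `m` bounding the degrees
of a finite generating set of `A`, each arrow of degree `m` is in `A` or generates a right ideal
disjoint from `A`, and each arrow extends to one with a prefix of degree `m`.

In the equivalence, aperiodicity matches fundamentality and cofinality matches being
`0`-simplifying. If `au` and `bu` are dependent for all `u`, then the shift `as ↦ bs` is a
non-idempotent commuting with all idempotents modulo `≡`; conversely, if `θ(a) = b` and `au`, `bu`
are independent, then `θ` does not commute with `1_{auC}` modulo `≡`. Cofinality says that each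
`1_{fC}` is, modulo `≡`, a finite join of idempotents `1_{xC}` isomorphic to subidempotents of `1_{eC}`, and
the ideal of morphisms supported on arrows whose domain reaches `e` (`RMonoid.reachIdeal`) detects
this.
-/

open InverseMonoidWithZero Arr

/-! ### The Lenz quotient of an inverse monoid -/

namespace InverseMonoidWithZero

variable {S : Type*} [InverseMonoidWithZero S]

theorem le_one_iff_idem {a : S} : a ≤ 1 ↔ a * a = a := by
  rw [le_iff_mul_idem]
  constructor
  · rintro ⟨e, he, rfl⟩
    simpa using he
  · exact fun h => ⟨a, h, (one_mul a).symm⟩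

theorem idem_le_iff {e f : S} (he : e * e = e) : e ≤ f ↔ e = f * e := by
  rw [le_def, inv_eq_of_idem he, mul_assoc, he]

/-- The natural order of `S/≡` is induced by the relation `LenzLE` on `S`. -/
theorem lenzMk_le_iff {s u : S} : lenzMk s ≤ lenzMk u ↔ LenzLE s u := by
  constructor
  · intro h
    have h' : lenzMk s = lenzMk (u * (s⁻¹ * s)) := by
      rw [lenzMk_mul, lenzMk_mul, lenzMk_inv, ← mul_assoc]
      exact h
    refine (lenzMk_eq_iff.1 h').1.trans fun x hx hxu => ?_
    exact ⟨x, hx, le_rfl, hxu.trans (mul_idem_le u (idem_inv_mul s))⟩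
  · intro h
    have key : lenzMk s = lenzMk (u * s⁻¹ * s) := by
      refine lenzMk_eq_iff.2 ⟨fun x hx hxs => ?_, fun x hx hxu => ?_⟩
      · obtain ⟨z, hz, hzx, hzu⟩ := h x hx hxs
        refine ⟨z, hz, hzx, ?_⟩
        have h1 : z * s⁻¹ * s = z :=
          mul_inv_mul_of_le_mul' (s := 1) (by rw [one_mul]; exact hzx.trans hxs)
        obtain ⟨e, he, rfl⟩ := le_iff_idem_mul.1 hzu
        exact le_iff_idem_mul.2 ⟨e, he, by rw [← mul_assoc, ← mul_assoc, h1]⟩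
      · obtain ⟨f, hf, rfl⟩ := le_iff_mul_idem.1 hxu
        -- `x = u * f` is compared with `s * f`, which lies below `s`, so that `LenzLE s u` applies
        have hsf : s * f ≠ 0 := fun h0 => hx (by rw [mul_assoc, h0, mul_zero])
        obtain ⟨z, hz, hzs, hzu⟩ := h _ hsf (mul_idem_le s hf)
        refine ⟨z, hz, ?_, hzs.trans (mul_idem_le s hf)⟩
        have h1 : z * f = z := by
          obtain ⟨e, he, rfl⟩ := le_iff_idem_mul.1 hzs
          rw [mul_assoc, mul_assoc, hf]
        have h2 : z * s⁻¹ * s = z :=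
          mul_inv_mul_of_le_mul' (s := 1)
            (by rw [one_mul]; exact hzs.trans (mul_idem_le s hf))
        obtain ⟨e, he, rfl⟩ := le_iff_idem_mul.1 hzu
        refine le_iff_idem_mul.2 ⟨e, he, ?_⟩
        rw [← mul_assoc, ← mul_assoc, ← mul_assoc, h2, h1]
    rw [lenzMk_mul, lenzMk_mul, lenzMk_inv] at key
    exact key

theorem IsAdditiveIdeal.zero_mem {I : Set S} (hI : IsAdditiveIdeal I) : (0 : S) ∈ I := by
  obtain ⟨p, hp⟩ := hI.nonempty
  rw [← zero_mul p]
  exact hI.mul_left_mem 0 p hp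

/-- In a distributive inverse monoid, the poset of idempotents is a Boolean algebra as soon as
each idempotent has a complement. -/
theorem IsDistributive.isBooleanInverseMonoid (hD : IsDistributive S)
    (hc : ∀ e : S, e * e = e → ∃ f : S, f * f = f ∧ e * f = 0 ∧ IsLUB {e, f} 1) :
    IsBooleanInverseMonoid S := by
  refine ⟨hD, ?_⟩
  let E := {e : S // IsIdempotentElem e}
  have hcompat : ∀ e f : E, Compatible (e : S) f := fun e f => by
    unfold Compatible
    rw [inv_eq_of_idem e.2, inv_eq_of_idem f.2]
    exact ⟨idem_mul e.2 f.2, idem_mul e.2 f.2⟩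
  have hjoin : ∀ e f : E, ∃ g : E, IsLUB {(e : S), (f : S)} g := fun e f => by
    obtain ⟨c, hcl⟩ := hD.exists_join e f (hcompat e f)
    refine ⟨⟨c, le_one_iff_idem.1 (hcl.2 ?_)⟩, hcl⟩
    rintro x (rfl | rfl)
    exacts [le_one_iff_idem.2 e.2, le_one_iff_idem.2 f.2]
  choose sup hsup using hjoin
  choose! cpl hcpl using hc
  let L : Lattice E :=
    { (inferInstance : PartialOrder E) with
      sup := sup
      inf := fun e f => ⟨e * f, idem_mul e.2 f.2⟩
      le_sup_left := fun e f => (hsup e f).1 (by simp)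
      le_sup_right := fun e f => (hsup e f).1 (by simp)
      sup_le := fun e f g h1 h2 => (hsup e f).2 (by
        rintro x (rfl | rfl)
        exacts [h1, h2])
      inf_le_left := fun e f => mul_idem_le (e : S) f.2
      inf_le_right := fun e f => idem_mul_le (f : S) e.2
      le_inf := fun e f g h1 h2 => by
        have h1' := (idem_le_iff e.2).1 h1
        have h2' := (idem_le_iff e.2).1 h2
        refine (idem_le_iff (f := (f * g : S)) e.2).2 ?_
        rw [mul_assoc, ← h2', ← h1'] }
  let D : DistribLattice E := DistribLattice.ofInfSupLe fun e f g =>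
    (hD.mul_join e f g (sup f g) (hcompat f g) (hsup f g)).2 (by
      have := (hsup ⟨e * f, idem_mul e.2 f.2⟩ ⟨e * g, idem_mul e.2 g.2⟩).1
      exact this)
  refine ⟨{ D with
    compl := fun e => ⟨cpl e, (hcpl e e.2).1⟩
    top := ⟨1, one_mul 1⟩
    bot := ⟨0, zero_mul 0⟩
    le_top := fun e => le_one_iff_idem.2 e.2
    bot_le := fun e => (idem_le_iff (f := (e : S)) (zero_mul 0)).2 (mul_zero _).symm
    inf_compl_le_bot := fun e => le_of_eq (Subtype.ext (hcpl e e.2).2.1)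
    top_le_sup_compl := fun e =>
      (hcpl e e.2).2.2.2 (hsup e ⟨cpl e, (hcpl e e.2).1⟩).1 }, fun e f => Iff.rfl⟩

end InverseMonoidWithZero

/-! ### Right ideals of arrows -/

namespace Arr

variable {C : Type u} [Category.{v} C]

theorem mem_rightIdeal_singleton {a c : Arr C} :
    c ∈ rightIdeal {a} ↔ ∃ (s : Arr C) (h : a.dom = s.cod), c = a.comp s h := by
  simp [rightIdeal]

theorem subset_rightIdeal {X : Set (Arr C)} {x : Arr C} (hx : x ∈ X) : x ∈ rightIdeal X :=
  ⟨x, hx, one x.dom, rfl, (comp_one x).symm⟩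

theorem one_comp (a : Arr C) : (one a.cod).comp a rfl = a := by
  simp [comp, one]

theorem isFGRightIdeal_rightIdeal {X : Set (Arr C)} (hX : X.Finite) :
    IsFGRightIdeal (rightIdeal X) := ⟨X, hX, rfl⟩

theorem IsFGRightIdeal.comp_mem {A : Set (Arr C)} (hA : IsFGRightIdeal A) {a : Arr C}
    (ha : a ∈ A) (s : Arr C) (h : a.dom = s.cod) : a.comp s h ∈ A := by
  obtain ⟨X, -, rfl⟩ := hA
  obtain ⟨x, hx, t, ht, rfl⟩ := ha
  exact ⟨x, hx, t.comp s h, ht, comp_assoc _ _ _ _ _⟩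

theorem rightIdeal_union (X Y : Set (Arr C)) :
    rightIdeal (X ∪ Y) = rightIdeal X ∪ rightIdeal Y := by
  ext c
  simp only [rightIdeal, Set.mem_union, Set.mem_ofPred_eq, or_and_right, exists_or]

theorem IsFGRightIdeal.union {A B : Set (Arr C)} (hA : IsFGRightIdeal A)
    (hB : IsFGRightIdeal B) : IsFGRightIdeal (A ∪ B) := by
  obtain ⟨X, hX, rfl⟩ := hA
  obtain ⟨Y, hY, rfl⟩ := hB
  exact ⟨X ∪ Y, hX.union hY, (rightIdeal_union X Y).symm⟩

theorem dependent_iff {a b : Arr C} :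
    Dependent a b ↔ ∃ (s t : Arr C) (hs : a.dom = s.cod) (ht : b.dom = t.cod),
      a.comp s hs = b.comp t ht := by
  constructor
  · rintro ⟨c, h1, h2⟩
    obtain ⟨s, hs, rfl⟩ := mem_rightIdeal_singleton.1 h1
    obtain ⟨t, ht, h⟩ := mem_rightIdeal_singleton.1 h2
    exact ⟨s, t, hs, ht, h⟩
  · rintro ⟨s, t, hs, ht, h⟩
    exact ⟨a.comp s hs, mem_rightIdeal_singleton.2 ⟨s, hs, rfl⟩,
      mem_rightIdeal_singleton.2 ⟨t, ht, h⟩⟩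

variable (C) in
/-- Right cancellation for arrows: `as = bs` implies `a = b`. -/
def IsRightCancellative : Prop :=
  ∀ (a b s : Arr C) (h : a.dom = s.cod) (h' : b.dom = s.cod), a.comp s h = b.comp s h' → a = b

variable (C) in
/-- Left cancellation for arrows: `as = at` implies `s = t`. -/
def IsLeftCancellative : Prop :=
  ∀ (a s t : Arr C) (h : a.dom = s.cod) (h' : a.dom = t.cod), a.comp s h = a.comp t h' → s = t

end Arr

/-! ### Factorization in higher rank graphs -/

namespace KGraph

variable {k : ℕ} {C : Type u} [Category.{v} C]

/-- Two factorizations of the same arrow whose left factors have the same degree agree. -/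
theorem factors_eq (G : KGraph k C) {a s b t : Arr C} {h : a.dom = s.cod} {h' : b.dom = t.cod}
    (hab : a.comp s h = b.comp t h') (hdeg : G.deg a = G.deg b) : a = b ∧ s = t := by
  have hd := congrArg G.deg hab
  rw [G.deg_comp, G.deg_comp, hdeg] at hd
  have hst : G.deg s = G.deg t := add_left_cancel hd
  have := (G.factorization (a.comp s h) (G.deg a) (G.deg s) (G.deg_comp _ _ _)).unique
    (y₁ := (a, s)) (y₂ := (b, t)) ⟨rfl, rfl, h, rfl⟩ ⟨hdeg.symm, hst.symm, h', hab⟩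
  exact Prod.ext_iff.1 this

theorem isRightCancellative (G : KGraph k C) : IsRightCancellative C := by
  intro a b s h h' hab
  have hd := congrArg G.deg hab
  rw [G.deg_comp, G.deg_comp] at hd
  exact (G.factors_eq hab (add_right_cancel hd)).1

theorem isLeftCancellative (G : KGraph k C) : IsLeftCancellative C :=
  fun _ _ _ _ _ hst => (G.factors_eq hst rfl).2

theorem exists_prefix (G : KGraph k C) (a : Arr C) {m : Fin k → ℕ} (hm : m ≤ G.deg a) :
    ∃ (y t : Arr C) (h : y.dom = t.cod), G.deg y = m ∧ a = y.comp t h := by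
  obtain ⟨⟨y, t⟩, ⟨hy, -, h, ha⟩, -⟩ :=
    G.factorization a m (G.deg a - m) (add_tsub_cancel_of_le hm).symm
  exact ⟨y, t, h, hy, ha⟩

/-- If `deg x ≤ deg y` and `x`, `y` are dependent, then `x` is the prefix of `y` of its degree. -/
theorem mem_rightIdeal_of_comp_eq (G : KGraph k C) {x y s t : Arr C} {hs : x.dom = s.cod}
    {ht : y.dom = t.cod} (h : x.comp s hs = y.comp t ht) (hdeg : G.deg x ≤ G.deg y) :
    y ∈ rightIdeal {x} := by
  obtain ⟨y₁, y₂, hy, hdy, rfl⟩ := G.exists_prefix y hdeg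
  have h' : x.comp s hs = y₁.comp (y₂.comp t ht) hy := h.trans (comp_assoc y₁ y₂ t hy ht)
  obtain ⟨rfl, -⟩ := G.factors_eq h' hdy.symm
  exact mem_rightIdeal_singleton.2 ⟨y₂, hy, rfl⟩

theorem RowFinite.finite_deg_eq [Finite C] {G : KGraph k C} (hrow : G.RowFinite)
    (m : Fin k → ℕ) : {x : Arr C | G.deg x = m}.Finite := by
  refine (Set.finite_iUnion fun e : C => hrow e m).subset fun x hx => ?_
  exact Set.mem_iUnion.2 ⟨x.cod, rfl, hx⟩

/-- Complements of finitely generated right ideals up to density: if `m` bounds the degrees of the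
generators of `A`, then the arrows of degree `m` outside `A` generate a right ideal disjoint from
`A`, and together with `A` it meets every principal right ideal. -/
theorem exists_complement [Finite C] {G : KGraph k C} (hrow : G.RowFinite) (hsrc : G.NoSources)
    {A : Set (Arr C)} (hA : IsFGRightIdeal A) :
    ∃ D : Set (Arr C), IsFGRightIdeal D ∧ A ∩ D = ∅ ∧
      ∀ a : Arr C, ∃ (u : Arr C) (h : a.dom = u.cod), a.comp u h ∈ A ∪ D := by
  have hcomp : ∀ a ∈ A, _ := fun a ha => hA.comp_mem ha
  obtain ⟨X, hX, rfl⟩ := hA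
  let m : Fin k → ℕ := hX.toFinset.sup G.deg
  have hm : ∀ x ∈ X, G.deg x ≤ m := fun x hx => Finset.le_sup (hX.mem_toFinset.2 hx)
  have hY : {y : Arr C | G.deg y = m ∧ y ∉ rightIdeal X}.Finite :=
    (hrow.finite_deg_eq m).subset fun y hy => hy.1
  refine ⟨_, isFGRightIdeal_rightIdeal hY, ?_, fun a => ?_⟩
  · rw [Set.eq_empty_iff_forall_notMem]
    rintro c ⟨⟨x, hx, s, hs, rfl⟩, y, ⟨hy, hyX⟩, t, ht, h⟩
    obtain ⟨r, hr, rfl⟩ :=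
      mem_rightIdeal_singleton.1 (G.mem_rightIdeal_of_comp_eq h ((hm x hx).trans hy.ge))
    exact hyX ⟨x, hx, r, hr, rfl⟩
  · obtain ⟨u, hu, hdu⟩ := hsrc a.dom m
    refine ⟨u, hu.symm, ?_⟩
    obtain ⟨y, t, h, hy, he⟩ := G.exists_prefix (a.comp u hu.symm) (m := m)
      (by rw [G.deg_comp, hdu]; exact le_add_self)
    rw [he]
    by_cases hyX : y ∈ rightIdeal X
    · exact Or.inl (hcomp y hyX t h)
    · exact Or.inr ⟨y, ⟨hy, hyX⟩, t, h, rfl⟩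

end KGraph

/-! ### Elements of `R(C)` as relations -/

namespace RMonoid

variable {C : Type u} [Category.{v} C]

/-- `θ.Rel a b` means that `θ` is defined at `a` with value `b`. -/
def Rel (θ : RMonoid C) (a b : Arr C) : Prop := b ∈ θ.1 a

theorem ext_rel {θ φ : RMonoid C} (h : ∀ a b, θ.Rel a b ↔ φ.Rel a b) : θ = φ :=
  Subtype.ext (PEquiv.ext fun a => Option.ext fun b => h a b)

theorem Rel.right_unique {θ : RMonoid C} {a b b' : Arr C} (h : θ.Rel a b) (h' : θ.Rel a b') :
    b = b' := Option.mem_unique h h'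

theorem Rel.left_unique {θ : RMonoid C} {a a' b : Arr C} (h : θ.Rel a b) (h' : θ.Rel a' b) :
    a = a' := θ.1.inj h h'

theorem Rel.dom_eq {θ : RMonoid C} {a b : Arr C} (h : θ.Rel a b) : b.dom = a.dom :=
  (θ.2.map_comp a b h (one a.dom) rfl).1

theorem Rel.comp {θ : RMonoid C} {a b : Arr C} (h : θ.Rel a b) (s : Arr C)
    (hs : a.dom = s.cod) : θ.Rel (a.comp s hs) (b.comp s (h.dom_eq.trans hs)) :=
  (θ.2.map_comp a b h s hs).2

/-- A relation on arrows that is the graph of a bijective morphism between finitely generated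
right ideals. -/
structure IsGraph (R : Arr C → Arr C → Prop) : Prop where
  right_unique : ∀ a b b', R a b → R a b' → b = b'
  left_unique : ∀ a a' b, R a b → R a' b → a = a'
  fg_dom : IsFGRightIdeal {a | ∃ b, R a b}
  fg_im : IsFGRightIdeal {b | ∃ a, R a b}
  map_comp : ∀ a b, R a b → ∀ (s : Arr C) (h : a.dom = s.cod),
    ∃ h' : b.dom = s.cod, R (a.comp s h) (b.comp s h')

theorem IsGraph.exists_rel_iff {R : Arr C → Arr C → Prop} (hR : IsGraph R) :
    ∃ θ : RMonoid C, ∀ a b, θ.Rel a b ↔ R a b := by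
  classical
  have aux : ∀ P : Arr C → Prop, (∀ b b', P b → P b' → b = b') →
      ∃ o : Option (Arr C), ∀ b, b ∈ o ↔ P b := by
    intro P hP
    by_cases h : ∃ b, P b
    · obtain ⟨b, hb⟩ := h
      refine ⟨some b, fun c => ?_⟩
      rw [Option.mem_some_iff]
      exact ⟨fun h => h ▸ hb, fun hc => hP _ _ hb hc⟩
    · exact ⟨none, fun c => by simpa using fun hc => h ⟨c, hc⟩⟩
  choose f hf using fun a => aux (R a) (hR.right_unique a)
  choose g hg using fun b => aux (fun a => R a b) fun a a' h h' => hR.left_unique a a' b h h'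
  let p : Arr C ≃. Arr C := ⟨f, g, fun a b => (hg b a).trans (hf a b).symm⟩
  have hp : ∀ a b, b ∈ p a ↔ R a b := hf
  refine ⟨⟨p, ?_, ?_, ?_⟩, hp⟩
  · simpa only [hp] using hR.fg_dom
  · simpa only [hp] using hR.fg_im
  · simpa only [hp] using hR.map_comp

/-- The bijective morphism with a given graph. -/
noncomputable def ofGraph {R : Arr C → Arr C → Prop} (hR : IsGraph R) : RMonoid C :=
  hR.exists_rel_iff.choose

@[simp] theorem rel_ofGraph {R : Arr C → Arr C → Prop} (hR : IsGraph R) {a b : Arr C} :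
    (ofGraph hR).Rel a b ↔ R a b := hR.exists_rel_iff.choose_spec a b

theorem isGraph_ideal {A : Set (Arr C)} (hA : IsFGRightIdeal A) :
    IsGraph fun a b : Arr C => b = a ∧ a ∈ A where
  right_unique := by rintro a b b' ⟨rfl, -⟩ ⟨rfl, -⟩; rfl
  left_unique := by rintro a a' b ⟨rfl, -⟩ ⟨rfl, -⟩; rfl
  fg_dom := by simpa using hA
  fg_im := by simpa using hA
  map_comp := by rintro a b ⟨rfl, hb⟩ s h; exact ⟨h, rfl, hA.comp_mem hb s h⟩

/-- The identity map of a finitely generated right ideal. -/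
noncomputable def idealId {A : Set (Arr C)} (hA : IsFGRightIdeal A) : RMonoid C :=
  ofGraph (isGraph_ideal hA)

@[simp] theorem rel_idealId {A : Set (Arr C)} (hA : IsFGRightIdeal A) {a b : Arr C} :
    (idealId hA).Rel a b ↔ b = a ∧ a ∈ A := rel_ofGraph _

/-- The identity map of the principal right ideal `aC`. -/
noncomputable abbrev principalId (a : Arr C) : RMonoid C :=
  idealId (isFGRightIdeal_rightIdeal (Set.finite_singleton a))

theorem isGraph_shift (hC : IsLeftCancellative C) {a b : Arr C} (hab : a.dom = b.dom) :
    IsGraph fun c d : Arr C => ∃ (s : Arr C) (h : a.dom = s.cod),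
      c = a.comp s h ∧ d = b.comp s (hab.symm.trans h) where
  right_unique := by
    rintro c d d' ⟨s, h, rfl, rfl⟩ ⟨s', h', hs, rfl⟩
    obtain rfl := hC _ _ _ _ _ hs
    rfl
  left_unique := by
    rintro c c' d ⟨s, h, rfl, rfl⟩ ⟨s', h', rfl, hs⟩
    obtain rfl := hC _ _ _ _ _ hs
    rfl
  fg_dom := by
    convert isFGRightIdeal_rightIdeal (Set.finite_singleton a) using 1
    ext c
    rw [mem_rightIdeal_singleton]
    constructor
    · rintro ⟨d, s, h, rfl, -⟩
      exact ⟨s, h, rfl⟩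
    · rintro ⟨s, h, rfl⟩
      exact ⟨_, s, h, rfl, rfl⟩
  fg_im := by
    convert isFGRightIdeal_rightIdeal (Set.finite_singleton b) using 1
    ext c
    rw [mem_rightIdeal_singleton]
    constructor
    · rintro ⟨d, s, h, -, rfl⟩
      exact ⟨s, hab.symm.trans h, rfl⟩
    · rintro ⟨s, h, rfl⟩
      exact ⟨_, s, hab.trans h, rfl, rfl⟩
  map_comp := by
    rintro c d ⟨s, h, rfl, rfl⟩ t ht
    exact ⟨ht, s.comp t ht, h, comp_assoc _ _ _ _ _, comp_assoc _ _ _ _ _⟩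

/-- The bijective morphism `aC → bC`, `as ↦ bs`, for arrows `a`, `b` with the same domain. -/
noncomputable def shift (hC : IsLeftCancellative C) {a b : Arr C} (hab : a.dom = b.dom) :
    RMonoid C := ofGraph (isGraph_shift hC hab)

@[simp] theorem rel_shift (hC : IsLeftCancellative C) {a b : Arr C} (hab : a.dom = b.dom)
    {c d : Arr C} : (shift hC hab).Rel c d ↔ ∃ (s : Arr C) (h : a.dom = s.cod),
      c = a.comp s h ∧ d = b.comp s (hab.symm.trans h) := rel_ofGraph _

theorem rel_shift_self (hC : IsLeftCancellative C) {a b : Arr C} (hab : a.dom = b.dom) :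
    (shift hC hab).Rel a b := by
  obtain ⟨bd, bc, b⟩ := b
  obtain rfl : a.dom = bd := hab
  exact (rel_shift hC (a := a) (b := ⟨a.dom, bc, b⟩) rfl).2 ⟨one a.dom, rfl, (comp_one a).symm,
    (comp_one (⟨a.dom, bc, b⟩ : Arr C)).symm⟩

variable [Finite C] [FinitelyAligned C]

theorem rel_mul {θ φ : RMonoid C} {a c : Arr C} :
    (θ * φ).Rel a c ↔ ∃ b, φ.Rel a b ∧ θ.Rel b c := PEquiv.mem_trans φ.1 θ.1 a c

theorem rel_inv {θ : RMonoid C} {a b : Arr C} : θ⁻¹.Rel a b ↔ θ.Rel b a :=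
  PEquiv.mem_iff_mem θ.1

theorem not_rel_zero {a b : Arr C} : ¬ (0 : RMonoid C).Rel a b := fun h => by
  change b ∈ (⊥ : Arr C ≃. Arr C) a at h
  simp at h

theorem rel_one {a b : Arr C} : (1 : RMonoid C).Rel a b ↔ b = a := by
  change b ∈ PEquiv.refl (Arr C) a ↔ b = a
  simp [eq_comm]

theorem ne_zero_iff {θ : RMonoid C} : θ ≠ 0 ↔ ∃ a b, θ.Rel a b := by
  constructor
  · intro h
    by_contra! h'
    exact h (ext_rel fun a b => iff_of_false (h' a b) not_rel_zero)
  · rintro ⟨a, b, h⟩ rfl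
    exact not_rel_zero h

theorem idem_iff {θ : RMonoid C} : θ * θ = θ ↔ ∀ a b, θ.Rel a b → b = a := by
  constructor
  · intro h a b hab
    have hab' := hab
    rw [← h] at hab'
    obtain ⟨c, hac, hcb⟩ := rel_mul.1 hab'
    obtain rfl := hac.right_unique hab
    exact hac.left_unique hcb ▸ rfl
  · intro h
    refine ext_rel fun a b => rel_mul.trans ⟨?_, fun hab => ?_⟩
    · rintro ⟨c, hac, hcb⟩
      obtain rfl := h _ _ hac
      exact hcb
    · obtain rfl := h _ _ hab
      exact ⟨_, hab, hab⟩

theorem le_iff {θ φ : RMonoid C} : θ ≤ φ ↔ ∀ a b, θ.Rel a b → φ.Rel a b := by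
  constructor
  · intro h a b hab
    obtain ⟨e, he, rfl⟩ := le_iff_mul_idem.1 h
    obtain ⟨c, hac, hcb⟩ := rel_mul.1 hab
    obtain rfl := idem_iff.1 he _ _ hac
    exact hcb
  · intro h
    refine ext_rel fun a b => ?_
    simp only [rel_mul, rel_inv]
    constructor
    · exact fun hab => ⟨b, hab, a, hab, h _ _ hab⟩
    · rintro ⟨c, hac, d, hdc, hdb⟩
      obtain rfl := hac.left_unique hdc
      exact (h _ _ hac).right_unique hdb ▸ hac

theorem idealId_idem {A : Set (Arr C)} (hA : IsFGRightIdeal A) :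
    idealId hA * idealId hA = idealId hA :=
  idem_iff.2 fun _ _ h => ((rel_idealId hA).1 h).1

theorem exists_idealId_of_idem {θ : RMonoid C} (h : θ * θ = θ) :
    ∃ (A : Set (Arr C)) (hA : IsFGRightIdeal A), θ = idealId hA := by
  refine ⟨_, θ.2.fg_dom, ext_rel fun a b => ?_⟩
  rw [rel_idealId]
  constructor
  · exact fun hab => ⟨idem_iff.1 h _ _ hab, b, hab⟩
  · rintro ⟨rfl, c, hc⟩
    obtain rfl := idem_iff.1 h _ _ hc
    exact hc

theorem rel_mul_principalId {θ : RMonoid C} {c a b : Arr C} :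
    (θ * principalId c).Rel a b ↔ a ∈ rightIdeal {c} ∧ θ.Rel a b := by
  rw [rel_mul]
  constructor
  · rintro ⟨d, h, hd⟩
    obtain ⟨rfl, h⟩ := (rel_idealId _).1 h
    exact ⟨h, hd⟩
  · rintro ⟨h, hd⟩
    exact ⟨a, (rel_idealId _).2 ⟨rfl, h⟩, hd⟩

/-- The relation `LenzLE` in terms of arrows: each pair `a ↦ b` of `θ` can be multiplied by some
`u` so as to become a pair `au ↦ bu` of `φ`. -/
theorem lenzLE_iff {θ φ : RMonoid C} :
    LenzLE θ φ ↔ ∀ a b, θ.Rel a b → ∃ (u : Arr C) (h : a.dom = u.cod) (h' : b.dom = u.cod),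
      φ.Rel (a.comp u h) (b.comp u h') := by
  constructor
  · intro hle a b hab
    obtain ⟨z, hz, hzx, hzφ⟩ :=
      hle (θ * principalId a)
        (ne_zero_iff.2 ⟨a, b, rel_mul_principalId.2 ⟨subset_rightIdeal rfl, hab⟩⟩)
        (mul_idem_le θ (idealId_idem _))
    obtain ⟨c, d, hcd⟩ := ne_zero_iff.1 hz
    obtain ⟨hc, hθ⟩ := rel_mul_principalId.1 (le_iff.1 hzx _ _ hcd)
    obtain ⟨u, hu, rfl⟩ := mem_rightIdeal_singleton.1 hc
    obtain rfl := hθ.right_unique (hab.comp u hu)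
    exact ⟨u, hu, hab.dom_eq.trans hu, le_iff.1 hzφ _ _ hcd⟩
  · intro h x hx hxθ
    obtain ⟨a, b, hab⟩ := ne_zero_iff.1 hx
    obtain ⟨u, hu, hu', hφ⟩ := h a b (le_iff.1 hxθ _ _ hab)
    refine ⟨x * principalId (a.comp u hu),
      ne_zero_iff.2 ⟨a.comp u hu, b.comp u hu',
        rel_mul_principalId.2 ⟨subset_rightIdeal rfl, hab.comp u hu⟩⟩,
      mul_idem_le x (idealId_idem _), le_iff.2 fun c d hcd => ?_⟩
    obtain ⟨hc, hx'⟩ := rel_mul_principalId.1 hcd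
    obtain ⟨s, hs, rfl⟩ := mem_rightIdeal_singleton.1 hc
    obtain rfl := hx'.right_unique ((hab.comp u hu).comp s hs)
    exact hφ.comp s hs

theorem lenzLE_idealId {A B : Set (Arr C)} {hA : IsFGRightIdeal A} {hB : IsFGRightIdeal B} :
    LenzLE (idealId hA) (idealId hB) ↔
      ∀ a ∈ A, ∃ (u : Arr C) (h : a.dom = u.cod), a.comp u h ∈ B := by
  rw [lenzLE_iff]
  constructor
  · intro h a ha
    obtain ⟨u, hu, hu', h'⟩ := h a a ((rel_idealId hA).2 ⟨rfl, ha⟩)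
    exact ⟨u, hu, ((rel_idealId hB).1 h').2⟩
  · intro h a b hab
    obtain ⟨rfl, ha⟩ := (rel_idealId hA).1 hab
    obtain ⟨u, hu, h'⟩ := h _ ha
    exact ⟨u, hu, hu, (rel_idealId hB).2 ⟨rfl, h'⟩⟩

/-- The Lenz congruence of `R(C)` is idempotent pure when `C` is right cancellative: from
`bu = au` one gets `b = a`. -/
theorem idem_of_lenzMk_idem (hC : IsRightCancellative C) {θ : RMonoid C}
    (h : lenzMk θ * lenzMk θ = lenzMk θ) : θ * θ = θ := by
  obtain ⟨e, he, hθ⟩ := exists_idem_lenzMk h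
  refine idem_iff.2 fun a b hab => ?_
  obtain ⟨u, hu, hu', h'⟩ := lenzLE_iff.1 (lenzMk_eq_iff.1 hθ).2 a b hab
  exact hC _ _ _ _ _ (idem_iff.1 he _ _ h')

theorem lenzMk_ne_zero_iff {θ : RMonoid C} : lenzMk θ ≠ 0 ↔ ∃ a b, θ.Rel a b := by
  rw [← ne_zero_iff]
  refine not_congr ⟨fun h => ?_, fun h => h ▸ lenzMk_zero⟩
  rw [← lenzMk_zero] at h
  by_contra h0
  obtain ⟨a, b, hab⟩ := ne_zero_iff.1 h0
  obtain ⟨u, hu, hu', h'⟩ := lenzLE_iff.1 (lenzMk_eq_iff.1 h).1 a b hab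
  exact not_rel_zero h'

/-! ### Joins of compatible elements -/

/-- If the graph of `j` is the union of the graphs of `s` and `t`, then `[j]` is the join of `[s]`
and `[t]`. -/
theorem isLUB_lenzMk {s t j : RMonoid C} (h : ∀ a b, j.Rel a b ↔ s.Rel a b ∨ t.Rel a b) :
    IsLUB {lenzMk s, lenzMk t} (lenzMk j) := by
  have key : ∀ u : RMonoid C, LenzLE j u ↔ LenzLE s u ∧ LenzLE t u := fun u => by
    simp only [lenzLE_iff, h]
    exact ⟨fun H => ⟨fun a b hab => H a b (.inl hab), fun a b hab => H a b (.inr hab)⟩,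
      fun H a b hab => hab.elim (H.1 a b) (H.2 a b)⟩
  have hj := (key j).1 (lenzMk_le_iff.1 le_rfl)
  constructor
  · rintro p (rfl | rfl)
    exacts [lenzMk_le_iff.2 hj.1, lenzMk_le_iff.2 hj.2]
  · intro p hp
    obtain ⟨u, rfl⟩ := lenzMk_surjective p
    exact lenzMk_le_iff.2 ((key u).2
      ⟨lenzMk_le_iff.1 (hp (by simp)), lenzMk_le_iff.1 (hp (by simp))⟩)

/-- Representatives of a compatible pair of `B(C)` have a union in `R(C)`, since compatibility
lifts along the idempotent pure congruence `≡`. -/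
theorem exists_union_of_compatible (hC : IsRightCancellative C) {s t : RMonoid C}
    (h : Compatible (lenzMk s) (lenzMk t)) :
    ∃ j : RMonoid C, ∀ a b, j.Rel a b ↔ s.Rel a b ∨ t.Rel a b := by
  have h1 : ∀ a a' b, s.Rel a b → t.Rel a' b → a = a' := fun a a' b hs ht =>
    idem_iff.1 (idem_of_lenzMk_idem hC (θ := s⁻¹ * t) h.1) a' a
      (rel_mul.2 ⟨b, ht, rel_inv.2 hs⟩)
  have h2 : ∀ a b b', s.Rel a b → t.Rel a b' → b = b' := fun a b b' hs ht =>
    idem_iff.1 (idem_of_lenzMk_idem hC (θ := s * t⁻¹) h.2) b' b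
      (rel_mul.2 ⟨a, rel_inv.2 ht, hs⟩)
  refine IsGraph.exists_rel_iff ⟨?_, ?_, ?_, ?_, ?_⟩
  · rintro a b b' (h | h) (h' | h')
    exacts [h.right_unique h', h2 _ _ _ h h', (h2 _ _ _ h' h).symm, h.right_unique h']
  · rintro a a' b (h | h) (h' | h')
    exacts [h.left_unique h', h1 _ _ _ h h', (h1 _ _ _ h' h).symm, h.left_unique h']
  · simp only [exists_or]
    exact s.2.fg_dom.union t.2.fg_dom
  · simp only [exists_or]
    exact s.2.fg_im.union t.2.fg_im
  · rintro a b (hab | hab) u hu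
    exacts [⟨hab.dom_eq.trans hu, .inl (hab.comp u hu)⟩,
      ⟨hab.dom_eq.trans hu, .inr (hab.comp u hu)⟩]

theorem isDistributive_bMonoid (hC : IsRightCancellative C) : IsDistributive (BMonoid C) where
  exists_join p q h := by
    obtain ⟨s, rfl⟩ := lenzMk_surjective p
    obtain ⟨t, rfl⟩ := lenzMk_surjective q
    obtain ⟨j, hj⟩ := exists_union_of_compatible hC h
    exact ⟨_, isLUB_lenzMk hj⟩
  mul_join r p q c h hc := by
    obtain ⟨s, rfl⟩ := lenzMk_surjective p
    obtain ⟨t, rfl⟩ := lenzMk_surjective q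
    obtain ⟨w, rfl⟩ := lenzMk_surjective r
    obtain ⟨j, hj⟩ := exists_union_of_compatible hC h
    obtain rfl := hc.unique (isLUB_lenzMk hj)
    simp only [← lenzMk_mul]
    exact isLUB_lenzMk fun a b => by simp only [rel_mul, hj, or_and_right, exists_or]
  join_mul r p q c h hc := by
    obtain ⟨s, rfl⟩ := lenzMk_surjective p
    obtain ⟨t, rfl⟩ := lenzMk_surjective q
    obtain ⟨w, rfl⟩ := lenzMk_surjective r
    obtain ⟨j, hj⟩ := exists_union_of_compatible hC h
    obtain rfl := hc.unique (isLUB_lenzMk hj)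
    simp only [← lenzMk_mul]
    exact isLUB_lenzMk fun a b => by simp only [rel_mul, hj, and_or_left, exists_or]

theorem isBooleanInverseMonoid_bMonoid {k : ℕ} {G : KGraph k C} (hrow : G.RowFinite)
    (hsrc : G.NoSources) : IsBooleanInverseMonoid (BMonoid C) := by
  refine (isDistributive_bMonoid G.isRightCancellative).isBooleanInverseMonoid fun p hp => ?_
  obtain ⟨e, he, rfl⟩ := exists_idem_lenzMk hp
  obtain ⟨A, hA, rfl⟩ := exists_idealId_of_idem he
  obtain ⟨D, hD, hAD, hdense⟩ := KGraph.exists_complement hrow hsrc hA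
  refine ⟨lenzMk (idealId hD), by rw [← lenzMk_mul, idealId_idem], ?_, ?_⟩
  · rw [← lenzMk_mul]
    by_contra h0
    obtain ⟨a, b, hab⟩ := lenzMk_ne_zero_iff.1 h0
    obtain ⟨c, hac, hcb⟩ := rel_mul.1 hab
    obtain ⟨rfl, hc⟩ := (rel_idealId hD).1 hac
    exact Set.eq_empty_iff_forall_notMem.1 hAD _ ⟨((rel_idealId hA).1 hcb).2, hc⟩
  · have h1 : (1 : BMonoid C) = lenzMk (idealId (hA.union hD)) := by
      rw [← lenzMk_one]
      refine lenzMk_eq_iff.2 ⟨lenzLE_iff.2 fun a b hab => ?_, lenzMk_le_iff.1 ?_⟩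
      · obtain rfl := rel_one.1 hab
        obtain ⟨u, hu, h⟩ := hdense b
        exact ⟨u, hu, hu, (rel_idealId _).2 ⟨rfl, h⟩⟩
      · rw [lenzMk_one, le_one_iff_idem, ← lenzMk_mul, idealId_idem]
    rw [h1]
    exact isLUB_lenzMk fun a b => by simp only [rel_idealId, Set.mem_union, and_or_left]

/-! ### Aperiodicity and fundamentality -/

/-- If `θ` moves `a` to `b ≠ a`, choose `u` with `au`, `bu` independent: then `[θ]` does not commute
with `[1_{auC}]`. -/
theorem isFundamental_of_isAperiodic (hA : IsAperiodicCategory C) :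
    IsFundamental (BMonoid C) := by
  intro p hp
  obtain ⟨θ, rfl⟩ := lenzMk_surjective p
  have hθ : θ * θ = θ := by
    refine idem_iff.2 fun a b hab => ?_
    by_contra hne
    obtain ⟨u, hu, hdep⟩ := hA a b hab.dom_eq.symm (Ne.symm hne)
    let E := principalId (a.comp u hu)
    have hcomm : lenzMk (θ * E) = lenzMk (E * θ) :=
      hp (lenzMk E) (congrArg lenzMk (idealId_idem _))
    obtain ⟨v, hv, hv', h⟩ := lenzLE_iff.1 (lenzMk_eq_iff.1 hcomm).1 (a.comp u hu) _
      (rel_mul_principalId.2 ⟨subset_rightIdeal rfl, hab.comp u hu⟩)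
    obtain ⟨c, hc, hE⟩ := rel_mul.1 h
    obtain ⟨rfl, hmem⟩ := (rel_idealId _).1 hE
    exact hdep ⟨_, hmem, mem_rightIdeal_singleton.2 ⟨v, hv', rfl⟩⟩
  exact congrArg lenzMk hθ

/-- If `au` and `bu` are dependent for all `u`, the shift `aC → bC` maps each right ideal into
itself up to density, so its class commutes with all idempotents. -/
theorem isAperiodic_of_isFundamental (hL : IsLeftCancellative C) (hR : IsRightCancellative C)
    (hF : IsFundamental (BMonoid C)) : IsAperiodicCategory C := by
  intro a b hab hne
  by_contra! hdep
  refine hne (Eq.symm (idem_iff.1 (idem_of_lenzMk_idem hR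
    (hF (lenzMk (shift hL hab)) fun p hp => ?_)) a b (rel_shift_self hL hab)))
  obtain ⟨e, he, rfl⟩ := exists_idem_lenzMk hp
  obtain ⟨A, hA, rfl⟩ := exists_idealId_of_idem he
  simp only [← lenzMk_mul]
  refine lenzMk_eq_iff.2 ⟨lenzLE_iff.2 fun c d hcd => ?_, lenzLE_iff.2 fun c d hcd => ?_⟩
  · obtain ⟨c', h1, h2⟩ := rel_mul.1 hcd
    obtain ⟨rfl, hc⟩ := (rel_idealId hA).1 h1
    obtain ⟨s, hs, rfl, rfl⟩ := (rel_shift hL hab).1 h2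
    obtain ⟨t, q, ht, hq, heq⟩ := dependent_iff.1 (hdep s hs)
    refine ⟨q, hq, hq, rel_mul.2 ⟨_, h2.comp q hq, (rel_idealId hA).2 ⟨rfl, ?_⟩⟩⟩
    rw [← heq]
    exact hA.comp_mem hc t ht
  · obtain ⟨d', h1, h2⟩ := rel_mul.1 hcd
    obtain ⟨rfl, hd⟩ := (rel_idealId hA).1 h2
    obtain ⟨s, hs, rfl, rfl⟩ := (rel_shift hL hab).1 h1
    obtain ⟨t, q, ht, hq, heq⟩ := dependent_iff.1 (hdep s hs)
    refine ⟨t, ht, ht, rel_mul.2 ⟨_, (rel_idealId hA).2 ⟨rfl, ?_⟩, h1.comp t ht⟩⟩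
    rw [heq]
    exact hA.comp_mem hd q hq

/-! ### Cofinality and additive ideals -/

/-- An additive ideal contains `[1_{XC}]` if it contains `[1_{xC}]` for each of the finitely many
generators `x ∈ X`. -/
theorem lenzMk_idealId_mem {I : Set (BMonoid C)} (hI : IsAdditiveIdeal I) {X : Set (Arr C)}
    (hX : X.Finite) (h : ∀ x ∈ X, lenzMk (principalId x) ∈ I) :
    lenzMk (idealId (isFGRightIdeal_rightIdeal hX)) ∈ I := by
  induction X, hX using Set.Finite.induction_on with
  | empty =>
    have h0 : lenzMk (idealId (isFGRightIdeal_rightIdeal (C := C) Set.finite_empty)) = 0 := by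
      by_contra h0
      obtain ⟨a, b, hab⟩ := lenzMk_ne_zero_iff.1 h0
      obtain ⟨x, hx, -⟩ := ((rel_idealId _).1 hab).2
      exact hx
    exact h0 ▸ hI.zero_mem
  | @insert x X hx hX ih =>
    have h1 := h x (Set.mem_insert _ _)
    have h2 := ih fun y hy => h y (Set.mem_insert_of_mem _ hy)
    refine hI.join_mem _ _ _ h1 h2 ?_ (isLUB_lenzMk fun a b => ?_)
    · unfold Compatible
      simp only [← lenzMk_inv, ← lenzMk_mul, inv_eq_of_idem (idealId_idem _)]
      have := idem_mul (idealId_idem (isFGRightIdeal_rightIdeal (Set.finite_singleton x)))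
        (idealId_idem (isFGRightIdeal_rightIdeal hX))
      exact ⟨congrArg lenzMk this, congrArg lenzMk this⟩
    · simp only [rel_idealId, Set.insert_eq, rightIdeal_union, Set.mem_union, and_or_left]

/-- Membership of `[1_{aC}]` in an additive ideal only depends on the domain of `a`, since `aC`
and `bC` are isomorphic when `a` and `b` have the same domain. -/
theorem lenzMk_principalId_mem_of_dom_eq (hL : IsLeftCancellative C) {I : Set (BMonoid C)}
    (hI : IsAdditiveIdeal I) {a b : Arr C} (hab : a.dom = b.dom)
    (h : lenzMk (principalId a) ∈ I) : lenzMk (principalId b) ∈ I := by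
  let σ := shift hL hab
  have : principalId b = σ * principalId a * σ⁻¹ := by
    refine ext_rel fun c d => ?_
    rw [rel_mul, rel_idealId, mem_rightIdeal_singleton]
    simp only [rel_mul_principalId, rel_inv]
    constructor
    · rintro ⟨rfl, s, hs, rfl⟩
      have hσ := (rel_shift hL hab).2 ⟨s, hab.trans hs, rfl, rfl⟩
      exact ⟨_, hσ, mem_rightIdeal_singleton.2 ⟨s, hab.trans hs, rfl⟩, hσ⟩
    · rintro ⟨e, h1, -, h2⟩
      obtain rfl := h1.right_unique h2
      obtain ⟨s, hs, -, rfl⟩ := (rel_shift hL hab).1 h1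
      exact ⟨rfl, s, _, rfl⟩
  rw [this, lenzMk_mul, lenzMk_mul]
  exact hI.mul_right_mem _ _ (hI.mul_left_mem _ _ h)

/-- If `x ∈ yC` then `xC ⊆ yC`, so `[1_{xC}]` is a multiple of `[1_{yC}]`. -/
theorem lenzMk_principalId_mem_of_mem {I : Set (BMonoid C)} (hI : IsAdditiveIdeal I)
    {x y : Arr C} (hxy : x ∈ rightIdeal {y}) (h : lenzMk (principalId y) ∈ I) :
    lenzMk (principalId x) ∈ I := by
  convert hI.mul_right_mem (lenzMk (principalId x)) _ h using 1
  rw [← lenzMk_mul]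
  congr 1
  refine ext_rel fun c d => ?_
  rw [rel_mul_principalId, rel_idealId, rel_idealId]
  constructor
  · rintro ⟨rfl, hd⟩
    obtain ⟨s, hs, rfl⟩ := mem_rightIdeal_singleton.1 hd
    exact ⟨hd, rfl, (isFGRightIdeal_rightIdeal (Set.finite_singleton y)).comp_mem hxy s hs⟩
  · exact fun h => ⟨h.2.1, h.1⟩

/-- If `θ` is defined at `a`, then `[1_{aC}]` is a multiple of `[θ]`. -/
theorem lenzMk_principalId_mem_of_rel {I : Set (BMonoid C)} (hI : IsAdditiveIdeal I)
    {θ : RMonoid C} (hp : lenzMk θ ∈ I) {a b : Arr C} (hab : θ.Rel a b) :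
    lenzMk (principalId a) ∈ I := by
  have : principalId a = θ⁻¹ * θ * principalId a := by
    refine ext_rel fun c d => ?_
    simp only [rel_mul_principalId, rel_mul (φ := θ), rel_inv, rel_idealId]
    constructor
    · rintro ⟨rfl, hd⟩
      refine ⟨hd, ?_⟩
      obtain ⟨s, hs, rfl⟩ := mem_rightIdeal_singleton.1 hd
      exact ⟨_, hab.comp s hs, hab.comp s hs⟩
    · rintro ⟨hc, e, h1, h2⟩
      exact ⟨h2.left_unique h1, hc⟩
  rw [this, lenzMk_mul, lenzMk_mul]
  exact hI.mul_right_mem _ _ (hI.mul_left_mem _ _ hp)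

/-- A non-zero additive ideal contains some `[1_{aC}]`, hence `[1_{eC}]` for the domain `e` of `a`.
Cofinality spreads this to `[1_{XC}]` for a large subset `X` of `fC`, that is, to `[1_{fC}]`, for
each `f`; the join of these over the finitely many `f` is `1`. -/
theorem isZeroSimplifying_of_isCofinal (hL : IsLeftCancellative C)
    (hC : IsCofinalCategory C) : IsZeroSimplifying (BMonoid C) := by
  intro I hI
  refine or_iff_not_imp_left.2 fun hne => ?_
  obtain ⟨p, hp, hp0⟩ : ∃ p ∈ I, p ≠ 0 := by
    by_contra! h
    exact hne (Set.eq_singleton_iff_unique_mem.2 ⟨hI.zero_mem, h⟩)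
  obtain ⟨θ, rfl⟩ := lenzMk_surjective p
  obtain ⟨a, b, hab⟩ := lenzMk_ne_zero_iff.1 hp0
  have ha := lenzMk_principalId_mem_of_rel hI hp hab
  have he : lenzMk (principalId (one a.dom)) ∈ I :=
    lenzMk_principalId_mem_of_dom_eq hL hI (a := a) (b := one a.dom) rfl ha
  have hf : ∀ f : C, lenzMk (principalId (one f)) ∈ I := by
    intro f
    obtain ⟨X, hX, ⟨hXf, hlarge⟩, hXe⟩ := hC a.dom f
    have hmem := lenzMk_idealId_mem hI hX fun x hx => by
      obtain ⟨w⟩ := hXe x hx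
      let w' : Arr C := ⟨x.dom, a.dom, w⟩
      have hw : w' ∈ rightIdeal {one a.dom} :=
        mem_rightIdeal_singleton.2 ⟨w', rfl, (one_comp w').symm⟩
      exact lenzMk_principalId_mem_of_dom_eq hL hI (a := w') rfl
        (lenzMk_principalId_mem_of_mem hI hw he)
    convert hmem using 1
    refine lenzMk_eq_iff.2 ⟨lenzLE_idealId.2 fun c hc => ?_, lenzLE_idealId.2 ?_⟩
    · obtain ⟨s, hs, rfl⟩ := mem_rightIdeal_singleton.1 hc
      obtain ⟨x, hx, hdep⟩ := hlarge ((one f).comp s hs) rfl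
      obtain ⟨u, v, hu, hv, heq⟩ := dependent_iff.1 hdep
      exact ⟨u, hu, x, hx, v, hv, heq⟩
    · rintro c ⟨x, hx, s, hs, rfl⟩
      refine ⟨one s.dom, rfl, ?_⟩
      obtain rfl := hXf x hx
      exact mem_rightIdeal_singleton.2
        ⟨x.comp s hs, rfl, (comp_one (x.comp s hs)).trans (one_comp (x.comp s hs)).symm⟩
  have hone : (1 : BMonoid C) ∈ I := by
    have hmem := lenzMk_idealId_mem hI (Set.finite_range (one (C := C)))
      (by rintro _ ⟨f, rfl⟩; exact hf f)
    convert hmem using 1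
    rw [← lenzMk_one]
    congr 1
    refine ext_rel fun c d => ?_
    rw [rel_one, rel_idealId]
    exact ⟨fun h => ⟨h, one c.cod, ⟨_, rfl⟩, c, rfl, (one_comp c).symm⟩, fun h => h.1⟩
  refine Set.eq_univ_of_forall fun q => ?_
  rw [← mul_one q]
  exact hI.mul_left_mem q 1 hone

/-- The classes of the bijective morphisms whose domain consists of arrows `a` such that there is
an arrow from the domain of `a` to `e`. -/
def reachIdeal (e : C) : Set (BMonoid C) :=
  {p | ∃ θ : RMonoid C, lenzMk θ = p ∧ ∀ a b, θ.Rel a b → Nonempty (a.dom ⟶ e)}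

theorem isAdditiveIdeal_reach (hR : IsRightCancellative C) (e : C) :
    IsAdditiveIdeal (reachIdeal e) where
  nonempty := ⟨0, 0, lenzMk_zero, fun _ _ h => (not_rel_zero h).elim⟩
  mul_left_mem := by
    rintro q _ ⟨θ, rfl, hθ⟩
    obtain ⟨φ, rfl⟩ := lenzMk_surjective q
    refine ⟨φ * θ, rfl, fun a b hab => ?_⟩
    obtain ⟨c, hc, -⟩ := rel_mul.1 hab
    exact hθ _ _ hc
  mul_right_mem := by
    rintro q _ ⟨θ, rfl, hθ⟩
    obtain ⟨φ, rfl⟩ := lenzMk_surjective q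
    refine ⟨θ * φ, rfl, fun a b hab => ?_⟩
    obtain ⟨c, hc, hcb⟩ := rel_mul.1 hab
    rw [← hc.dom_eq]
    exact hθ _ _ hcb
  join_mem := by
    rintro _ _ r ⟨s, rfl, hs⟩ ⟨t, rfl, ht⟩ hcompat hlub
    obtain ⟨j, hj⟩ := exists_union_of_compatible hR hcompat
    exact ⟨j, (isLUB_lenzMk hj).unique hlub, fun a b hab =>
      ((hj a b).1 hab).elim (hs a b) (ht a b)⟩

/-- The ideal `reachIdeal e` contains `[1_{eC}] ≠ 0`, hence also `[1_{fC}]`; generators of the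
domain of a representative of the latter taken from the definition of `reachIdeal e` form a large subset
of `fC`. -/
theorem isCofinal_of_isZeroSimplifying (hR : IsRightCancellative C)
    (hZ : IsZeroSimplifying (BMonoid C)) : IsCofinalCategory C := by
  intro e f
  have hmem : lenzMk (principalId (one f)) ∈ reachIdeal e := by
    rcases hZ _ (isAdditiveIdeal_reach hR e) with h | h
    · have h1 : lenzMk (principalId (one e)) ∈ reachIdeal e := by
        refine ⟨_, rfl, fun a b hab => ?_⟩
        obtain ⟨s, hs, rfl⟩ := mem_rightIdeal_singleton.1 ((rel_idealId _).1 hab).2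
        exact ⟨((one e).comp s hs).hom⟩
      rw [h] at h1
      have h2 : (principalId (one e)).Rel (one e) (one e) :=
        (rel_idealId _).2 ⟨rfl, subset_rightIdeal rfl⟩
      exact absurd h1 (lenzMk_ne_zero_iff.2 ⟨_, _, h2⟩)
    · rw [h]
      trivial
  obtain ⟨θ, hθ, hreach⟩ := hmem
  have hidem : θ * θ = θ := idem_of_lenzMk_idem hR (by
    rw [hθ, ← lenzMk_mul, idealId_idem])
  obtain ⟨A, hA, rfl⟩ := exists_idealId_of_idem hidem
  obtain ⟨h1, h2⟩ := lenzMk_eq_iff.1 hθ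
  obtain ⟨X, hX, rfl⟩ := id hA
  refine ⟨X, hX, ⟨fun x hx => ?_, fun b hb => ?_⟩, fun x hx => ?_⟩
  · obtain ⟨u, hu, h⟩ := lenzLE_idealId.1 h1 x (subset_rightIdeal hx)
    obtain ⟨s, hs, heq⟩ := mem_rightIdeal_singleton.1 h
    exact congrArg Arr.cod heq
  · subst hb
    obtain ⟨u, hu, x, hx, s, hs, heq⟩ := lenzLE_idealId.1 h2 b
      (mem_rightIdeal_singleton.2 ⟨b, rfl, (one_comp b).symm⟩)
    exact ⟨x, hx, dependent_iff.2 ⟨u, s, hu, hs, heq⟩⟩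
  · exact hreach x x ((rel_idealId hA).2 ⟨rfl, subset_rightIdeal hx⟩)

end RMonoid

theorem mainTheorem3 {k : ℕ} {C : Type u} [Category.{v} C] (G : KGraph k C)
    [Finite C] [FinitelyAligned C] (hrow : G.RowFinite) (hsrc : G.NoSources) :
    InverseMonoidWithZero.IsBooleanInverseMonoid (BMonoid C) ∧
      ((IsAperiodicCategory C ∧ IsCofinalCategory C) ↔ InverseMonoidWithZero.IsSimple (BMonoid C)) := by
  have hL := G.isLeftCancellative
  have hR := G.isRightCancellative
  refine ⟨RMonoid.isBooleanInverseMonoid_bMonoid hrow hsrc, fun h => ?_, fun h => ?_⟩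
  · exact ⟨RMonoid.isFundamental_of_isAperiodic h.1,
      RMonoid.isZeroSimplifying_of_isCofinal hL h.2⟩
  · exact ⟨RMonoid.isAperiodic_of_isFundamental hL hR h.1,
      RMonoid.isCofinal_of_isZeroSimplifying hR h.2⟩
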